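/- Let $N_d, Q, L, K\ge 0$ and $\delta\ge 1$ be integers, $N=N_dQ$, and let $S=[s_1^{(1)},\dots,s_1^{(Q)},\dots,s_{N_d}^{(1)},\dots,s_{N_d}^{(Q)}]\in\mathbb C^{L\times N}$ be an arbitrary (deterministic) signature matrix with nonzero columns $s_n^{(q)}$. Its coherence is $$\mu(S)=\max_{(n,q)\ne(n',q')}\frac{|\langle s_n^{(q)},s_{n'}^{(q')}\rangle|}{\|s_n^{(q)}\|_2\,\|s_{n'}^{(q')}\|_2}$$ (and $\mu(S)=0$ if $N\le 1$). Let $g_1,\dots,g_{N_d}>0$ be large-scale fading coefficients and $\sigma_w^2>0$ the noise variance. For $n\le N_d$, $l\le L$ and antennas $m=1,2,\dots$, let $h_{n,m}\sim\mathcal{CN}(0,1)$ and $w_{l,m}\sim\mathcal{CN}(0,\sigma_w^2)$ be circularly symmetric complex Gaussian random variables, all jointly independent, on a common probability space. An activity pattern is $a=(a_n^{(q)})$ with $a_n^{(q)}\in\{0,1\}$ and $\sum_q a_n^{(q)}\in\{0,1\}$ for every $n$; device $n$ is active if $\sum_q a_n^{(q)}=1$. The true parameter is $\gamma^0=(g_n^2a_n^{(q)})_{n,q}\in\mathbb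 R^N$. The signal received at the first $M$ antennas is $$Y=\sum_{n=1}^{N_d}\sum_{q=1}^{Q}a_n^{(q)}g_n\,s_n^{(q)}h_n^T+W\in\mathbb C^{L\times M},\qquad h_n=(h_{n,1},\dots,h_{n,M})^T,\quad W=(w_{l,m}),$$ and $\widehat\Sigma=\frac1M YY^H$. A covariance-based maximum-likelihood (ML) estimate $\widehat\gamma=\widehat\gamma_M$ is any minimizer of $$\log\det\Sigma(\gamma)+\operatorname{tr}\big(\Sigma(\gamma)^{-1}\widehat\Sigma\big),\qquad \Sigma(\gamma)=S\operatorname{diag}(\gamma)S^H+\sigma_w^2 I,$$ over $\gamma\in\mathbb R^N$ with $\gamma\ge0$ entrywise. Suppose $K+\delta>1$ and $$\mu(S)<\frac{1}{\sqrt{K+\delta-1}}.$$ Then, with probability exceeding $1-2^{-\delta}$, the following holds for every activity pattern with exactly $K$ active devices: ML estimates exist for every $M\ge1$, and $\widehat\gamma_M\to\gamma^0$ as $M\to\infty$ for every choice of ML estimates $\widehat\gamma_M$. -/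

import Mathlib

open MeasureTheory ProbabilityTheory Filter Topology
open scoped NNReal Matrix

namespace GrantFree

noncomputable section

/-- The coherence `max_{k ≠ l} |⟨x_k, x_l⟩| / (‖x_k‖₂ ‖x_l‖₂)` over the columns of a matrix
(equal to `0` if there are fewer than two columns). -/
def coherence {m n : Type*} [Fintype m] (X : Matrix m n ℂ) : ℝ :=
  ⨆ p : {p : n × n // p.1 ≠ p.2},
    ‖inner ℂ (WithLp.toLp 2 (X.col p.1.1)) (WithLp.toLp 2 (X.col p.1.2))‖ /
      (‖WithLp.toLp 2 (X.col p.1.1)‖ * ‖WithLp.toLp 2 (X.col p.1.2)‖)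

/-- The circularly symmetric complex Gaussian law `CN(0, v)`: real and imaginary parts are
independent, each `N(0, v / 2)`. -/
def complexGaussian (v : ℝ≥0) : Measure ℂ :=
  ((gaussianReal 0 (v / 2)).prod (gaussianReal 0 (v / 2))).map
    Complex.measurableEquivRealProd.symm

/-- `a n q ∈ {0, 1}` indicates whether device `n` transmits its `q`-th sequence; every device
transmits at most one sequence. -/
def IsIndicator {Nd Q : ℕ} (a : Fin Nd → Fin Q → ℝ) : Prop :=
  (∀ n q, a n q = 0 ∨ a n q = 1) ∧ ∀ n, (∑ q, |a n q| = 0) ∨ (∑ q, |a n q| = 1)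

/-- The set of active devices. -/
def activeDevices {Nd Q : ℕ} (a : Fin Nd → Fin Q → ℝ) : Set (Fin Nd) :=
  {n | ∑ q, |a n q| = 1}

/-- The true parameter `γ⁰`, with entries `g_n² a_n^{(q)}`. -/
def trueGamma {Nd Q : ℕ} (g : Fin Nd → ℝ) (a : Fin Nd → Fin Q → ℝ) : Fin Nd × Fin Q → ℝ :=
  fun i => g i.1 ^ 2 * a i.1 i.2

/-- The received signal at the first `M` antennas,
`Y = ∑_n ∑_q a_n^{(q)} g_n s_n^{(q)} h_nᵀ + W`. -/
def receivedSignal {L Nd Q : ℕ} (S : Matrix (Fin L) (Fin Nd × Fin Q) ℂ) (g : Fin Nd → ℝ)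
    (a : Fin Nd → Fin Q → ℝ) (h : Fin Nd → ℕ → ℂ) (w : Fin L → ℕ → ℂ) (M : ℕ) :
    Matrix (Fin L) (Fin M) ℂ :=
  Matrix.of fun l m => (∑ n, ∑ q, (a n q : ℂ) * (g n : ℂ) * S l (n, q) * h n m) + w l m

/-- The sample covariance `(1 / M) Y Yᴴ`. -/
def sampleCov {L M : ℕ} (Y : Matrix (Fin L) (Fin M) ℂ) : Matrix (Fin L) (Fin L) ℂ :=
  (1 / (M : ℂ)) • (Y * Yᴴ)

/-- The model covariance `S diag(γ) Sᴴ + σ_w² I`; here `v = σ_w²`. -/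
def modelCov {L Nd Q : ℕ} (S : Matrix (Fin L) (Fin Nd × Fin Q) ℂ) (v : ℝ≥0)
    (γ : Fin Nd × Fin Q → ℝ) : Matrix (Fin L) (Fin L) ℂ :=
  S * Matrix.diagonal (fun i => (γ i : ℂ)) * Sᴴ + ((v : ℝ) : ℂ) • 1

/-- The objective `log |Σ| + tr(Σ⁻¹ C)`, where `Σ` is the model covariance at `γ`. For `γ ≥ 0`,
`v > 0` and `C` positive semidefinite, the determinant and the trace are real. -/
def mlObjective {L Nd Q : ℕ} (S : Matrix (Fin L) (Fin Nd × Fin Q) ℂ) (v : ℝ≥0)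
    (C : Matrix (Fin L) (Fin L) ℂ) (γ : Fin Nd × Fin Q → ℝ) : ℝ :=
  Real.log (modelCov S v γ).det.re + ((modelCov S v γ)⁻¹ * C).trace.re

/-- `γ` solves the covariance-based maximum-likelihood problem: it minimizes the objective with
sample covariance `C` subject to `γ ≥ 0`. -/
def IsMLEstimate {L Nd Q : ℕ} (S : Matrix (Fin L) (Fin Nd × Fin Q) ℂ) (v : ℝ≥0)
    (C : Matrix (Fin L) (Fin L) ℂ) (γ : Fin Nd × Fin Q → ℝ) : Prop :=
  (∀ i, 0 ≤ γ i) ∧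
    ∀ γ' : Fin Nd × Fin Q → ℝ, (∀ i, 0 ≤ γ' i) → mlObjective S v C γ ≤ mlObjective S v C γ'

/-- The channel gains `h n m` (device `n`, antenna `m`) are `CN(0, 1)`, the noise entries `w l m`
are `CN(0, v)`, and all of them are jointly independent. -/
structure IsChannelModel {Ω : Type*} [MeasurableSpace Ω] (P : Measure Ω) {L Nd : ℕ} (v : ℝ≥0)
    (h : Fin Nd → ℕ → Ω → ℂ) (w : Fin L → ℕ → Ω → ℂ) : Prop where
  law_channel : ∀ n m, HasLaw (h n m) (complexGaussian 1) P
  law_noise : ∀ l m, HasLaw (w l m) (complexGaussian v) P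
  indep : iIndepFun
    (Sum.elim (fun p : Fin Nd × ℕ => h p.1 p.2) (fun p : Fin L × ℕ => w p.1 p.2)) P

end

end GrantFree

/-! The event can be taken of probability one. The strong law makes the finitely many empirical
cross-moments of gains and noise converge off a null set that depends on the channel alone, hence
serves all activity patterns and all choices of estimates. There the sample covariance tends to
`Σ(γ⁰)` (`tendsto_sampleCov`); the rest is deterministic.

Consistency (`tendsto_of_isMLEstimate`): the eigenvalues of `Σ(γ)` are at least the noise variance,
so `log det Σ(γ)` is coercive on `γ ≥ 0` and the minimizers eventually lie in a compact box. A
cluster point `γ` is no worse than `γ⁰` for the limit objective, and strict Gaussian likelihood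
comparison forces `Σ(γ) = Σ(γ⁰)`.

Identifiability (`eq_zero_of_gram_sum_eq_zero`): `γ - γ⁰`, rescaled by squared column norms, is `p -
q` with `p, q ≥ 0` of disjoint supports and `q` living on at most `K` indices. The trace gives `∑ p
= ∑ q`. Testing against the `k`-th unit column where `q k > 0` gives `q k ≤ μ² ∑ p = μ² ∑ q`.
Summing over `k` yields `∑ q ≤ K μ² ∑ q`, so `q = 0` and then `p = 0`. -/

namespace GrantFree

/-! ### Identifiability from small coherence -/

section Identifiability

/-- A combination of rank-one projections onto unit vectors that vanishes, and whose coefficients are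
nonnegative off a set `T` with `|T| c < 1`, is trivial. Stated through `G i j = |⟨u_i, u_j⟩|²`, with
`c` bounding the off-diagonal entries. -/
theorem eq_zero_of_gram_sum_eq_zero {ι : Type*} [Fintype ι] [DecidableEq ι] (G : ι → ι → ℝ) (c : ℝ)
    (hG1 : ∀ i, G i i = 1) (hG0 : ∀ i j, 0 ≤ G i j) (hGc : ∀ i j, i ≠ j → G i j ≤ c)
    (T : Finset ι) (hT : T.card * c < 1) (x : ι → ℝ) (hx : ∀ i ∉ T, 0 ≤ x i)
    (hsum : ∑ i, x i = 0) (hgram : ∀ k, ∑ i, x i * G i k = 0) : x = 0 := by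
  set p : ι → ℝ := fun i => max (x i) 0 with hp
  set q : ι → ℝ := fun i => max (-x i) 0 with hq
  have hp0 : ∀ i, 0 ≤ p i := fun i => le_max_right _ _
  have hq0 : ∀ i, 0 ≤ q i := fun i => le_max_right _ _
  have hpq : ∀ i, x i = p i - q i := fun i => by
    simp only [hp, hq]
    rcases le_total (x i) 0 with h | h
    · rw [max_eq_right h, max_eq_left (by linarith)]; ring
    · rw [max_eq_left h, max_eq_right (by linarith)]; ring
  have hpq0 : ∀ i, p i = 0 ∨ q i = 0 := fun i => by
    rcases le_total (x i) 0 with h | h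
    · exact Or.inl (max_eq_right h)
    · exact Or.inr (max_eq_right (by linarith))
  have hqT : ∀ i ∉ T, q i = 0 := fun i hi => max_eq_right (by linarith [hx i hi])
  have hPQ : ∑ i, p i = ∑ i, q i := by
    have : ∑ i, p i - ∑ i, q i = 0 := by
      rw [← Finset.sum_sub_distrib, ← hsum]; exact Finset.sum_congr rfl fun i _ => (hpq i).symm
    linarith
  -- If `p k = 0`, the unit diagonal entry of `G` acts only on the `q` side, so the `p` side sees
  -- only entries at most `c`.
  have hqle : ∀ k, q k ≤ c * ∑ i, q i ∨ q k = 0 := fun k => by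
    rcases hpq0 k with hk | hk
    · left
      have h1 : ∑ i, p i * G i k = ∑ i, q i * G i k := by
        have h2 := hgram k
        simp_rw [hpq, sub_mul, Finset.sum_sub_distrib] at h2
        linarith
      have h3 : q k ≤ ∑ i, q i * G i k := by
        have := Finset.single_le_sum (f := fun i => q i * G i k)
          (fun i _ => mul_nonneg (hq0 i) (hG0 i k)) (Finset.mem_univ k)
        simpa [hG1] using this
      have h4 : ∑ i, p i * G i k ≤ ∑ i, c * p i := by
        refine Finset.sum_le_sum fun i _ => ?_
        by_cases hik : i = k
        · subst hik; simp [hk]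
        · nlinarith [hGc i k hik, hp0 i]
      rw [← Finset.mul_sum, hPQ] at h4
      linarith
    · exact Or.inr hk
  have hqs : ∑ i, q i = ∑ i ∈ T, q i :=
    (Finset.sum_subset (Finset.subset_univ T) fun i _ hi => hqT i hi).symm
  have hq_sum : ∑ i, q i = 0 := by
    by_contra hne
    have hpos : 0 < ∑ i, q i :=
      lt_of_le_of_ne (Finset.sum_nonneg fun i _ => hq0 i) (Ne.symm hne)
    obtain ⟨k, -, hk⟩ : ∃ k ∈ Finset.univ, q k ≠ 0 := Finset.exists_ne_zero_of_sum_ne_zero hne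
    -- The sign of `c` is not assumed; a nonzero `q k` supplies what is needed.
    have hc : 0 ≤ c * ∑ i, q i := (hq0 k).trans ((hqle k).resolve_right hk)
    have h5 : ∑ i ∈ T, q i ≤ ∑ _i ∈ T, c * ∑ i, q i :=
      Finset.sum_le_sum fun i _ => (hqle i).elim id fun h => h ▸ hc
    rw [Finset.sum_const, nsmul_eq_mul, ← hqs, ← mul_assoc] at h5
    nlinarith
  have hq_zero : ∀ i, q i = 0 := fun i =>
    (Finset.sum_eq_zero_iff_of_nonneg fun i _ => hq0 i).1 hq_sum i (Finset.mem_univ i)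
  have hp_zero : ∀ i, p i = 0 := fun i =>
    (Finset.sum_eq_zero_iff_of_nonneg fun i _ => hp0 i).1 (hPQ.trans hq_sum) i (Finset.mem_univ i)
  funext i
  simp [hpq i, hq_zero i, hp_zero i]

theorem coherence_nonneg {m n : Type*} [Fintype m] (X : Matrix m n ℂ) : 0 ≤ coherence X :=
  Real.iSup_nonneg fun _ => by positivity

theorem norm_inner_le_coherence_mul {m n : Type*} [Fintype m] [Finite n] (X : Matrix m n ℂ)
    {i j : n} (hij : i ≠ j) :
    ‖inner ℂ (WithLp.toLp 2 (X.col i)) (WithLp.toLp 2 (X.col j))‖ ≤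
      coherence X * (‖WithLp.toLp 2 (X.col i)‖ * ‖WithLp.toLp 2 (X.col j)‖) := by
  have h := le_ciSup (f := fun p : {p : n × n // p.1 ≠ p.2} =>
    ‖inner ℂ (WithLp.toLp 2 (X.col p.1.1)) (WithLp.toLp 2 (X.col p.1.2))‖ /
      (‖WithLp.toLp 2 (X.col p.1.1)‖ * ‖WithLp.toLp 2 (X.col p.1.2)‖))
    (Set.finite_range _).bddAbove ⟨(i, j), hij⟩
  -- For a zero column the quotient carries no information, and Cauchy–Schwarz gives the bound.
  by_cases h0 : ‖WithLp.toLp 2 (X.col i)‖ * ‖WithLp.toLp 2 (X.col j)‖ = 0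
  · have := norm_inner_le_norm (𝕜 := ℂ) (WithLp.toLp 2 (X.col i)) (WithLp.toLp 2 (X.col j))
    rw [h0] at this ⊢
    simpa using this
  · exact (div_le_iff₀ (lt_of_le_of_ne (by positivity) (Ne.symm h0))).1 h

/-- `x ↦ X diag(x) Xᴴ` is injective along directions that are nonnegative off a set of at most `K`
indices, provided `K μ(X)² < 1`. -/
theorem eq_zero_of_mul_diagonal_mul_conjTranspose_eq_zero {m n : Type*} [Fintype m] [Fintype n]
    [DecidableEq n] (X : Matrix m n ℂ) (hX : ∀ i, X.col i ≠ 0) (T : Finset n)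
    (hT : T.card * coherence X ^ 2 < 1) (x : n → ℝ) (hx : ∀ i ∉ T, 0 ≤ x i)
    (h : X * Matrix.diagonal (fun i => (x i : ℂ)) * Xᴴ = 0) : x = 0 := by
  set u : n → EuclideanSpace ℂ m := fun i => WithLp.toLp 2 (X.col i) with hu
  have hupos : ∀ i, 0 < ‖u i‖ := fun i => by
    rw [norm_pos_iff, Ne, WithLp.toLp_eq_zero]; exact hX i
  have hquad : ∀ y z : m → ℂ, ∑ i, (x i : ℂ) * (inner ℂ (WithLp.toLp 2 y) (u i) *
      inner ℂ (u i) (WithLp.toLp 2 z)) = 0 := fun y z => by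
    have h1 : star y ⬝ᵥ (X * Matrix.diagonal (fun i => (x i : ℂ)) * Xᴴ) *ᵥ z = 0 := by simp [h]
    rw [← h1, ← Matrix.mulVec_mulVec, ← Matrix.mulVec_mulVec, Matrix.dotProduct_mulVec,
      dotProduct]
    refine Finset.sum_congr rfl fun i _ => ?_
    rw [Matrix.mulVec_diagonal, EuclideanSpace.inner_eq_star_dotProduct,
      EuclideanSpace.inner_eq_star_dotProduct]
    simp only [Matrix.vecMul, Matrix.mulVec, dotProduct, hu, Matrix.conjTranspose_apply,
      Matrix.col_apply, Pi.star_apply]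
    rw [mul_left_comm]
    congr 1
    · exact Finset.sum_congr rfl fun j _ => mul_comm _ _
    · congr 1
      exact Finset.sum_congr rfl fun j _ => mul_comm _ _
  have hquad' : ∀ y : m → ℂ, ∑ i, x i * ‖inner ℂ (u i) (WithLp.toLp 2 y)‖ ^ 2 = 0 := fun y => by
    have h1 := hquad y y
    have h2 : ∀ i, inner ℂ (WithLp.toLp 2 y) (u i) * inner ℂ (u i) (WithLp.toLp 2 y) =
        ((‖inner ℂ (u i) (WithLp.toLp 2 y)‖ ^ 2 : ℝ) : ℂ) := fun i => by
      rw [← inner_conj_symm, mul_comm, Complex.mul_conj, Complex.normSq_eq_norm_sq]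
    simp_rw [h2] at h1
    exact_mod_cast h1
  -- Normalizing the columns moves `‖u i‖ ^ 2` into the coefficients. The sum condition is the trace
  -- of the vanishing matrix; the Gram condition is its quadratic form at column `k`.
  have key := eq_zero_of_gram_sum_eq_zero
    (fun i k => ‖inner ℂ (u i) (u k)‖ ^ 2 / (‖u i‖ ^ 2 * ‖u k‖ ^ 2)) (coherence X ^ 2)
    (fun i => by
      have := hupos i
      rw [inner_self_eq_norm_sq_to_K]
      simp only [Complex.coe_algebraMap, norm_pow, Complex.norm_real, norm_norm]
      field_simp)
    (fun i j => by positivity)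
    (fun i j hij => by
      have h1 := norm_inner_le_coherence_mul X hij
      have := hupos i; have := hupos j
      rw [div_le_iff₀ (by positivity), ← mul_pow, ← mul_pow]
      gcongr)
    T hT (fun i => x i * ‖u i‖ ^ 2) (fun i hi => mul_nonneg (hx i hi) (by positivity))
    (by
      have h1 : ∀ l, (X * Matrix.diagonal (fun i => (x i : ℂ)) * Xᴴ) l l = 0 := fun l => by simp [h]
      have h2 : (∑ l, ∑ i, x i * ‖X l i‖ ^ 2 : ℝ) = 0 := by
        refine Finset.sum_eq_zero fun l _ => ?_
        have h3 := h1 l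
        rw [Matrix.mul_apply] at h3
        simp only [Matrix.mul_diagonal, Matrix.conjTranspose_apply] at h3
        have h4 : ∀ i, X l i * (x i : ℂ) * star (X l i) = ((x i * ‖X l i‖ ^ 2 : ℝ) : ℂ) := fun i => by
          rw [mul_right_comm, Complex.star_def, Complex.mul_conj, Complex.normSq_eq_norm_sq]
          push_cast; ring
        simp_rw [h4] at h3
        exact_mod_cast h3
      rw [Finset.sum_comm] at h2
      rw [← h2]
      refine Finset.sum_congr rfl fun i _ => ?_
      rw [EuclideanSpace.norm_sq_eq, Finset.mul_sum]
      rfl)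
    (fun k => by
      have hk := hupos k
      have h1 := hquad' (X.col k)
      have h2 : ∀ i, x i * ‖u i‖ ^ 2 * (‖inner ℂ (u i) (u k)‖ ^ 2 / (‖u i‖ ^ 2 * ‖u k‖ ^ 2)) =
          x i * ‖inner ℂ (u i) (u k)‖ ^ 2 * (‖u k‖ ^ 2)⁻¹ := fun i => by
        have := hupos i
        field_simp
      simp only [h2, ← Finset.sum_mul]
      rw [h1, zero_mul])
  funext i
  have h1 := congrFun key i
  have := hupos i
  simp only [Pi.zero_apply, mul_eq_zero, pow_eq_zero_iff two_ne_zero] at h1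
  exact h1.resolve_right this.ne'

end Identifiability

end GrantFree

namespace GrantFree

/-! ### Positive definite matrices: trace, determinant, likelihood -/

section PosDef

open scoped ComplexOrder MatrixOrder

variable {n : Type*} [Fintype n] [DecidableEq n]

theorem det_re_eq_prod_eigenvalues {A : Matrix n n ℂ} (hA : A.IsHermitian) :
    A.det.re = ∏ i, hA.eigenvalues i := by
  rw [hA.det_eq_prod_eigenvalues]
  exact_mod_cast Complex.ofReal_re (∏ i, hA.eigenvalues i)

theorem trace_re_eq_sum_eigenvalues {A : Matrix n n ℂ} (hA : A.IsHermitian) :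
    A.trace.re = ∑ i, hA.eigenvalues i := by
  rw [hA.trace_eq_sum_eigenvalues]
  exact_mod_cast Complex.ofReal_re (∑ i, hA.eigenvalues i)

theorem det_re_pos {A : Matrix n n ℂ} (hA : A.PosDef) : 0 < A.det.re :=
  (Complex.pos_iff.1 hA.det_pos).1

theorem det_eq_ofReal_re {A : Matrix n n ℂ} (hA : A.PosDef) : A.det = (A.det.re : ℂ) :=
  Complex.ext rfl (by simpa using (Complex.pos_iff.1 hA.det_pos).2.symm)

/-- Among positive definite matrices, only the identity satisfies `tr B - log det B ≤ dim`. -/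
theorem eq_one_of_trace_sub_log_det_le {B : Matrix n n ℂ} (hB : B.PosDef)
    (h : B.trace.re - Real.log B.det.re ≤ Fintype.card n) : B = 1 := by
  have hpos := hB.eigenvalues_pos
  rw [det_re_eq_prod_eigenvalues hB.1, trace_re_eq_sum_eigenvalues hB.1,
    Real.log_prod (fun i _ => (hpos i).ne')] at h
  -- Each term is nonnegative by `log t ≤ t - 1`, with equality only at `t = 1`.
  have h1 : ∑ i, (hB.1.eigenvalues i - 1 - Real.log (hB.1.eigenvalues i)) = 0 := by
    refine le_antisymm ?_ (Finset.sum_nonneg fun i _ => ?_)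
    · simp only [Finset.sum_sub_distrib, Finset.sum_const, Finset.card_univ, nsmul_eq_mul, mul_one]
      linarith
    · linarith [Real.log_le_sub_one_of_pos (hpos i)]
  have h2 : hB.1.eigenvalues = 1 := by
    funext i
    by_contra hne
    have h3 := (Finset.sum_eq_zero_iff_of_nonneg fun i _ => by
      linarith [Real.log_le_sub_one_of_pos (hpos i)]).1 h1 i (Finset.mem_univ i)
    linarith [Real.log_lt_sub_one_of_pos (hpos i) hne]
  have h4 := hB.1.spectral_theorem
  rw [h2] at h4
  rw [h4]
  have : (RCLike.ofReal ∘ (1 : n → ℝ) : n → ℂ) = fun _ => 1 := by funext i; simp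
  rw [this, Matrix.diagonal_one, map_one]

theorem exists_eq_conjTranspose_mul_self {A : Matrix n n ℂ} (hA : A.PosDef) :
    ∃ R : Matrix n n ℂ, IsUnit R ∧ A = Rᴴ * R := by
  obtain ⟨R, hR, h⟩ :=
    CStarAlgebra.isStrictlyPositive_iff_eq_star_mul_self.mp hA.isStrictlyPositive
  exact ⟨R, hR, h⟩

/-- With `A⁻¹ = Rᴴ R`, this is the trace of `R C Rᴴ`. It lets the data term be dropped when bounding
the objective below. -/
theorem trace_inv_mul_nonneg {A C : Matrix n n ℂ} (hA : A.PosDef) (hC : C.PosSemidef) :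
    0 ≤ (A⁻¹ * C).trace.re := by
  obtain ⟨R, -, hR⟩ := exists_eq_conjTranspose_mul_self hA.inv
  rw [hR, Matrix.mul_assoc, Matrix.trace_mul_comm]
  exact (Complex.nonneg_iff.1 (hC.mul_mul_conjTranspose_same R).trace_nonneg).1

/-- The Gaussian log-likelihood `log det A + tr (A⁻¹ B)` is uniquely minimized at `A = B`. -/
theorem eq_of_log_det_add_trace_le {A B : Matrix n n ℂ} (hA : A.PosDef) (hB : B.PosDef)
    (h : Real.log A.det.re + (A⁻¹ * B).trace.re ≤ Real.log B.det.re + (B⁻¹ * B).trace.re) :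
    A = B := by
  obtain ⟨R, hRu, hR⟩ := exists_eq_conjTranspose_mul_self hB
  have hAdet : IsUnit A.det := hA.det_pos.ne'.isUnit
  have hBdet : IsUnit B.det := hB.det_pos.ne'.isUnit
  have hinj : Function.Injective R.vecMul := Matrix.vecMul_injective_of_isUnit hRu
  -- A Hermitian stand-in for `A⁻¹ B`, with the same trace and determinant; it reduces the
  -- comparison to the case of the identity.
  have hD : (R * A⁻¹ * Rᴴ).PosDef := hA.inv.mul_mul_conjTranspose_same hinj
  have htr : (R * A⁻¹ * Rᴴ).trace = (A⁻¹ * B).trace := by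
    rw [hR, Matrix.mul_assoc, Matrix.trace_mul_comm, Matrix.mul_assoc]
  have hdet : (R * A⁻¹ * Rᴴ).det * A.det = B.det := by
    rw [hR, Matrix.det_mul, Matrix.det_mul, Matrix.det_mul, Matrix.det_nonsing_inv]
    rw [mul_right_comm, mul_assoc R.det, Ring.inverse_mul_cancel _ hAdet]
    ring
  have hdet' : (R * A⁻¹ * Rᴴ).det.re * A.det.re = B.det.re := by
    rw [det_eq_ofReal_re hD, det_eq_ofReal_re hA, det_eq_ofReal_re hB] at hdet
    exact_mod_cast hdet
  have hlog : Real.log (R * A⁻¹ * Rᴴ).det.re + Real.log A.det.re = Real.log B.det.re := by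
    rw [← hdet', Real.log_mul (det_re_pos hD).ne' (det_re_pos hA).ne']
  have hone : R * A⁻¹ * Rᴴ = 1 := by
    refine eq_one_of_trace_sub_log_det_le hD ?_
    rw [Matrix.nonsing_inv_mul _ hBdet, Matrix.trace_one] at h
    rw [htr]
    simp only [Complex.natCast_re] at h
    linarith
  have h1 : A⁻¹ * (Rᴴ * R) = 1 := by
    have h2 : R * (A⁻¹ * Rᴴ) = 1 := by rw [← Matrix.mul_assoc]; exact hone
    rw [← Matrix.mul_assoc]
    exact mul_eq_one_comm.1 h2
  have h3 := congrArg (A * ·) h1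
  simp only [Matrix.mul_nonsing_inv_cancel_left _ _ hAdet, mul_one] at h3
  rw [hR, h3]

/-- An eigenvalue is the Rayleigh quotient at a unit eigenvector, where `B` contributes a
nonnegative amount. -/
theorem le_eigenvalues_add_smul_one {B : Matrix n n ℂ} (hB : B.PosSemidef) (v : ℝ)
    (hA : (B + (v : ℂ) • 1).IsHermitian) (i : n) : v ≤ hA.eigenvalues i := by
  rw [hA.eigenvalues_eq, Matrix.add_mulVec, dotProduct_add, Matrix.smul_mulVec, Matrix.one_mulVec,
    dotProduct_smul, map_add]
  have h1 := hB.re_dotProduct_nonneg (hA.eigenvectorBasis i)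
  have h2 : star (hA.eigenvectorBasis i).ofLp ⬝ᵥ (hA.eigenvectorBasis i).ofLp = 1 := by
    rw [dotProduct_comm, ← EuclideanSpace.inner_eq_star_dotProduct, inner_self_eq_norm_sq_to_K,
      hA.eigenvectorBasis.orthonormal.1 i]
    simp
  rw [h2]
  simpa using h1

/-- The determinant of `B + v I` controls its trace when `B` is positive semidefinite. -/
theorem pow_mul_trace_re_le_card_mul_det_re {B : Matrix n n ℂ} (hB : B.PosSemidef) {v : ℝ}
    (hv : 0 < v) (hA : (B + (v : ℂ) • 1).IsHermitian) :
    v ^ (Fintype.card n - 1) * (B + (v : ℂ) • 1).trace.re ≤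
      Fintype.card n * (B + (v : ℂ) • 1).det.re := by
  have hle := le_eigenvalues_add_smul_one hB v hA
  rw [trace_re_eq_sum_eigenvalues hA, det_re_eq_prod_eigenvalues hA, Finset.mul_sum,
    ← nsmul_eq_mul, ← Finset.card_univ, ← Finset.sum_const]
  refine Finset.sum_le_sum fun i _ => ?_
  -- The determinant is the `i`-th eigenvalue times the others, each at least `v`.
  rw [← Finset.mul_prod_erase _ _ (Finset.mem_univ i), mul_comm]
  refine mul_le_mul_of_nonneg_left ?_ (hv.le.trans (hle i))
  rw [← Finset.card_erase_of_mem (Finset.mem_univ i), ← Finset.prod_const]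
  exact Finset.prod_le_prod (fun _ _ => hv.le) fun j _ => hle j

end PosDef

/-! ### Existence and consistency of minimizers -/

section MaximumLikelihood

open scoped ComplexOrder

variable {L Nd Q : ℕ} (S : Matrix (Fin L) (Fin Nd × Fin Q) ℂ) {v : ℝ≥0}

theorem posSemidef_mul_diagonal {γ : Fin Nd × Fin Q → ℝ} (hγ : ∀ i, 0 ≤ γ i) :
    (S * Matrix.diagonal (fun i => (γ i : ℂ)) * Sᴴ).PosSemidef :=
  (Matrix.PosSemidef.diagonal fun i => by simpa using hγ i).mul_mul_conjTranspose_same S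

theorem modelCov_posDef (hv : 0 < v) {γ : Fin Nd × Fin Q → ℝ} (hγ : ∀ i, 0 ≤ γ i) :
    (modelCov S v γ).PosDef :=
  Matrix.PosDef.posSemidef_add (posSemidef_mul_diagonal S hγ)
    (Matrix.PosDef.one.smul (by simpa using hv))

theorem sampleCov_posSemidef {M : ℕ} (Y : Matrix (Fin L) (Fin M) ℂ) :
    (sampleCov Y).PosSemidef :=
  (Matrix.posSemidef_self_mul_conjTranspose Y).smul (by positivity)

theorem trace_mul_diagonal_mul_conjTranspose_re (γ : Fin Nd × Fin Q → ℝ) :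
    (S * Matrix.diagonal (fun i => (γ i : ℂ)) * Sᴴ).trace.re =
      ∑ i, γ i * ∑ l, ‖S l i‖ ^ 2 := by
  simp only [Matrix.trace, Matrix.diag_apply, Matrix.mul_apply (N := Sᴴ), Matrix.mul_diagonal,
    Matrix.conjTranspose_apply, Complex.re_sum]
  rw [Finset.sum_comm]
  refine Finset.sum_congr rfl fun i _ => ?_
  rw [Finset.mul_sum]
  refine Finset.sum_congr rfl fun l _ => ?_
  rw [mul_right_comm, Complex.star_def, Complex.mul_conj, Complex.normSq_eq_norm_sq, mul_comm,
    ← Complex.ofReal_mul, Complex.ofReal_re]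

/-- Sublevel sets of the log-determinant are bounded. -/
theorem exists_bound_of_log_det_le (hS : ∀ i, S.col i ≠ 0) (hv : 0 < v) (c : ℝ) :
    ∃ B : Fin Nd × Fin Q → ℝ, ∀ γ : Fin Nd × Fin Q → ℝ, (∀ i, 0 ≤ γ i) →
      Real.log (modelCov S v γ).det.re ≤ c → ∀ i, γ i ≤ B i := by
  have hcol : ∀ i, 0 < ∑ l, ‖S l i‖ ^ 2 := fun i => by
    obtain ⟨l, hl⟩ := Function.ne_iff.1 (hS i)
    have hl' : S l i ≠ 0 := hl
    exact Finset.sum_pos' (fun _ _ => by positivity) ⟨l, Finset.mem_univ l, by positivity⟩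
  -- Comes from `v^(L-1) γ i ‖s i‖² ≤ v^(L-1) tr Σ ≤ L det Σ ≤ L exp c`.
  refine ⟨fun i => L * Real.exp c / ((v : ℝ) ^ (L - 1) * ∑ l, ‖S l i‖ ^ 2), fun γ hγ hc i => ?_⟩
  have hpd := modelCov_posDef S hv hγ
  have hv' : (0 : ℝ) < v := hv
  have hdet : (modelCov S v γ).det.re ≤ Real.exp c :=
    (Real.log_le_iff_le_exp (det_re_pos hpd)).1 hc
  have h1 := pow_mul_trace_re_le_card_mul_det_re (posSemidef_mul_diagonal S hγ) hv' hpd.1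
  rw [Fintype.card_fin] at h1
  have h2 : γ i * ∑ l, ‖S l i‖ ^ 2 ≤ (modelCov S v γ).trace.re := by
    rw [modelCov, Matrix.trace_add, Complex.add_re, trace_mul_diagonal_mul_conjTranspose_re,
      Matrix.trace_smul, Matrix.trace_one]
    have h3 := Finset.single_le_sum (f := fun i => γ i * ∑ l, ‖S l i‖ ^ 2)
      (fun i _ => mul_nonneg (hγ i) (hcol i).le) (Finset.mem_univ i)
    have h4 : 0 ≤ (((v : ℝ) : ℂ) • ((Fintype.card (Fin L) : ℕ) : ℂ)).re := by
      simp only [Fintype.card_fin, smul_eq_mul, Complex.re_ofReal_mul, Complex.natCast_re]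
      positivity
    linarith
  rw [le_div_iff₀ (mul_pos (pow_pos hv' _) (hcol i))]
  calc γ i * ((v : ℝ) ^ (L - 1) * ∑ l, ‖S l i‖ ^ 2)
      = (v : ℝ) ^ (L - 1) * (γ i * ∑ l, ‖S l i‖ ^ 2) := by ring
    _ ≤ (v : ℝ) ^ (L - 1) * (modelCov S v γ).trace.re := by gcongr
    _ ≤ L * (modelCov S v γ).det.re := h1
    _ ≤ L * Real.exp c := by gcongr

theorem continuous_modelCov : Continuous (modelCov S v) := by
  unfold modelCov
  fun_prop

/-- Joint continuity in data and parameter, for an arbitrary filter so that it applies to sequences,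
neighbourhoods and ultrafilters alike. -/
theorem tendsto_mlObjective (hv : 0 < v) {ι : Type*} {l : Filter ι}
    {C : ι → Matrix (Fin L) (Fin L) ℂ} {C₀ : Matrix (Fin L) (Fin L) ℂ}
    {γ : ι → Fin Nd × Fin Q → ℝ} {γ₀ : Fin Nd × Fin Q → ℝ} (hγ₀ : ∀ i, 0 ≤ γ₀ i)
    (hC : Tendsto C l (𝓝 C₀)) (hγ : Tendsto γ l (𝓝 γ₀)) :
    Tendsto (fun k => mlObjective S v (C k) (γ k)) l (𝓝 (mlObjective S v C₀ γ₀)) := by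
  have hpd := modelCov_posDef S hv hγ₀
  have hmod : Tendsto (fun k => modelCov S v (γ k)) l (𝓝 (modelCov S v γ₀)) :=
    ((continuous_modelCov S).tendsto γ₀).comp hγ
  have hdet : Tendsto (fun k => (modelCov S v (γ k)).det) l (𝓝 (modelCov S v γ₀).det) :=
    ((continuous_id.matrix_det).tendsto _).comp hmod
  have hadj : Tendsto (fun k => (modelCov S v (γ k)).adjugate) l
      (𝓝 (modelCov S v γ₀).adjugate) :=
    ((continuous_id.matrix_adjugate).tendsto _).comp hmod
  have hinv : Tendsto (fun k => (modelCov S v (γ k))⁻¹) l (𝓝 (modelCov S v γ₀)⁻¹) := by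
    simp only [Matrix.inv_def, Ring.inverse_eq_inv']
    have hne : (modelCov S v γ₀).det ≠ 0 := hpd.det_pos.ne'
    exact Tendsto.smul (Tendsto.inv₀ hdet hne) hadj
  refine Tendsto.add ?_ ?_
  · exact (((Complex.continuous_re.tendsto _).comp hdet)).log (det_re_pos hpd).ne'
  · have hmul : Tendsto (fun k => (modelCov S v (γ k))⁻¹ * C k) l (𝓝 ((modelCov S v γ₀)⁻¹ * C₀)) :=
      Tendsto.mul hinv hC
    exact (Complex.continuous_re.tendsto _).comp (((continuous_id.matrix_trace).tendsto _).comp hmul)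

theorem log_det_le_mlObjective (hv : 0 < v) {C : Matrix (Fin L) (Fin L) ℂ} (hC : C.PosSemidef)
    {γ : Fin Nd × Fin Q → ℝ} (hγ : ∀ i, 0 ≤ γ i) :
    Real.log (modelCov S v γ).det.re ≤ mlObjective S v C γ :=
  le_add_of_nonneg_right (trace_inv_mul_nonneg (modelCov_posDef S hv hγ) hC)

theorem exists_isMLEstimate (hS : ∀ i, S.col i ≠ 0) (hv : 0 < v)
    {C : Matrix (Fin L) (Fin L) ℂ} (hC : C.PosSemidef) : ∃ γ, IsMLEstimate S v C γ := by
  obtain ⟨B, hB⟩ := exists_bound_of_log_det_le S hS hv (mlObjective S v C 0)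
  have h0 : (0 : Fin Nd × Fin Q → ℝ) ∈ Set.Icc 0 B :=
    ⟨le_rfl, hB 0 (fun _ => le_rfl) (log_det_le_mlObjective S hv hC fun _ => le_rfl)⟩
  obtain ⟨γ, hγ, hmin⟩ := (isCompact_Icc (a := (0 : Fin Nd × Fin Q → ℝ)) (b := B)).exists_isMinOn
    ⟨0, h0⟩ (f := mlObjective S v C) fun γ hγ =>
      (tendsto_mlObjective S hv hγ.1 tendsto_const_nhds tendsto_id).mono_left nhdsWithin_le_nhds
  refine ⟨γ, hγ.1, fun γ' hγ' => ?_⟩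
  -- A competitor no worse than `0` lies in the box; any other already loses to `0`.
  by_cases hle : mlObjective S v C γ' ≤ mlObjective S v C 0
  · exact hmin ⟨hγ', hB γ' hγ' ((log_det_le_mlObjective S hv hC hγ').trans hle)⟩
  · exact (hmin h0).trans (not_le.1 hle).le

/-- Consistency of maximum-likelihood estimates under identifiability: if the sample covariances
converge to the model covariance at `γ₀` and `γ₀` is determined by that covariance, then the
estimates converge to `γ₀`. -/
theorem tendsto_of_isMLEstimate (hS : ∀ i, S.col i ≠ 0) (hv : 0 < v)
    {C : ℕ → Matrix (Fin L) (Fin L) ℂ} (hC : ∀ M, (C M).PosSemidef)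
    {γ₀ : Fin Nd × Fin Q → ℝ} (hγ₀ : ∀ i, 0 ≤ γ₀ i)
    (hlim : Tendsto C atTop (𝓝 (modelCov S v γ₀)))
    (hident : ∀ γ : Fin Nd × Fin Q → ℝ, (∀ i, 0 ≤ γ i) → modelCov S v γ = modelCov S v γ₀ → γ = γ₀)
    {γhat : ℕ → Fin Nd × Fin Q → ℝ} (hML : ∀ M, 1 ≤ M → IsMLEstimate S v (C M) (γhat M)) :
    Tendsto γhat atTop (𝓝 γ₀) := by
  have hobj : Tendsto (fun M => mlObjective S v (C M) γ₀) atTop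
      (𝓝 (mlObjective S v (modelCov S v γ₀) γ₀)) :=
    tendsto_mlObjective S hv hγ₀ hlim tendsto_const_nhds
  set c := mlObjective S v (modelCov S v γ₀) γ₀ + 1
  obtain ⟨B, hB⟩ := exists_bound_of_log_det_le S hS hv c
  have hmem : ∀ᶠ M in atTop, γhat M ∈ Set.Icc 0 B := by
    filter_upwards [eventually_ge_atTop 1, hobj.eventually (gt_mem_nhds (lt_add_one _))]
      with M hM hlt
    obtain ⟨hpos, hmin⟩ := hML M hM
    exact ⟨hpos, hB _ hpos (((log_det_le_mlObjective S hv (hC M) hpos).trans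
      (hmin γ₀ hγ₀)).trans hlt.le)⟩
  -- In a compact box it suffices to identify cluster points; an ultrafilter turns one into a
  -- genuine limit, along which the minimizing inequality passes.
  refine isCompact_Icc.tendsto_nhds_of_unique_mapClusterPt hmem fun γ hγ hcl => ?_
  obtain ⟨U, hU, hUγ⟩ := mapClusterPt_iff_ultrafilter.1 hcl
  refine hident γ hγ.1 (eq_of_log_det_add_trace_le (modelCov_posDef S hv hγ.1)
    (modelCov_posDef S hv hγ₀) ?_)
  refine le_of_tendsto_of_tendsto
    (tendsto_mlObjective S hv hγ.1 (hlim.mono_left hU) hUγ) (hobj.mono_left hU) ?_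
  filter_upwards [hU (eventually_ge_atTop 1)] with M hM
  exact (hML M hM).2 γ₀ hγ₀

end MaximumLikelihood

end GrantFree

namespace GrantFree

/-! ### Moments of the complex Gaussian law -/

section ComplexGaussian

variable (v : ℝ≥0)

instance isProbabilityMeasure_complexGaussian : IsProbabilityMeasure (complexGaussian v) :=
  Measure.isProbabilityMeasure_map Complex.measurableEquivRealProd.symm.measurable.aemeasurable

theorem hasLaw_re_complexGaussian :
    HasLaw Complex.re (gaussianReal 0 (v / 2)) (complexGaussian v) where
  aemeasurable := Complex.measurable_re.aemeasurable
  map_eq := by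
    rw [complexGaussian, Measure.map_map Complex.measurable_re
      Complex.measurableEquivRealProd.symm.measurable]
    exact measurePreserving_fst.map_eq

theorem hasLaw_im_complexGaussian :
    HasLaw Complex.im (gaussianReal 0 (v / 2)) (complexGaussian v) where
  aemeasurable := Complex.measurable_im.aemeasurable
  map_eq := by
    rw [complexGaussian, Measure.map_map Complex.measurable_im
      Complex.measurableEquivRealProd.symm.measurable]
    exact measurePreserving_snd.map_eq

theorem memLp_two_of_hasLaw_gaussianReal {Ω : Type*} {mΩ : MeasurableSpace Ω} {P : Measure Ω}
    {X : Ω → ℝ} (hX : HasLaw X (gaussianReal 0 v) P) : MemLp X 2 P := by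
  have h := memLp_id_gaussianReal' (μ := 0) (v := v) 2 (by simp)
  rw [← hX.map_eq, memLp_map_measure_iff aestronglyMeasurable_id hX.aemeasurable] at h
  exact h

theorem integral_of_hasLaw_gaussianReal {Ω : Type*} {mΩ : MeasurableSpace Ω} {P : Measure Ω}
    {X : Ω → ℝ} (hX : HasLaw X (gaussianReal 0 v) P) : ∫ ω, X ω ∂P = 0 := by
  rw [hX.integral_eq, integral_id_gaussianReal]

theorem integral_sq_of_hasLaw_gaussianReal {Ω : Type*} {mΩ : MeasurableSpace Ω} {P : Measure Ω}
    {X : Ω → ℝ} (hX : HasLaw X (gaussianReal 0 v) P) : ∫ ω, X ω ^ 2 ∂P = v := by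
  have h1 := hX.variance_eq
  rw [variance_id_gaussianReal, variance_of_integral_eq_zero hX.aemeasurable
    (integral_of_hasLaw_gaussianReal v hX)] at h1
  exact h1

theorem memLp_two_id_complexGaussian : MemLp (id : ℂ → ℂ) 2 (complexGaussian v) := by
  have h1 := (memLp_two_of_hasLaw_gaussianReal _ (hasLaw_re_complexGaussian v)).ofReal (K := ℂ)
  have h2 := (memLp_two_of_hasLaw_gaussianReal _ (hasLaw_im_complexGaussian v)).ofReal (K := ℂ)
  have h3 := h1.add (h2.mul_const Complex.I)
  refine h3.congr_norm measurable_id.aestronglyMeasurable (ae_of_all _ fun z => ?_)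
  simp only [Pi.add_apply]
  exact congrArg norm (Complex.re_add_im z)

theorem integral_id_complexGaussian : ∫ z, z ∂complexGaussian v = 0 := by
  have hint : Integrable (fun z : ℂ => z) (complexGaussian v) :=
    (memLp_two_id_complexGaussian v).integrable one_le_two
  have h := integral_re_add_im hint
  rw [← h]
  have h1 := integral_of_hasLaw_gaussianReal _ (hasLaw_re_complexGaussian v)
  have h2 := integral_of_hasLaw_gaussianReal _ (hasLaw_im_complexGaussian v)
  simp only [RCLike.re_to_complex, RCLike.im_to_complex, h1, h2]
  simp

theorem integral_mul_conj_complexGaussian :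
    ∫ z, z * (starRingEnd ℂ) z ∂complexGaussian v = ((v : ℝ) : ℂ) := by
  have h1 : ∀ z : ℂ, z * (starRingEnd ℂ) z = ((z.re ^ 2 + z.im ^ 2 : ℝ) : ℂ) := fun z => by
    rw [Complex.mul_conj, Complex.normSq_apply]; ring_nf
  simp_rw [h1]
  rw [integral_complex_ofReal, integral_add
    (memLp_two_of_hasLaw_gaussianReal _ (hasLaw_re_complexGaussian v)).integrable_sq
    (memLp_two_of_hasLaw_gaussianReal _ (hasLaw_im_complexGaussian v)).integrable_sq,
    integral_sq_of_hasLaw_gaussianReal _ (hasLaw_re_complexGaussian v),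
    integral_sq_of_hasLaw_gaussianReal _ (hasLaw_im_complexGaussian v)]
  push_cast
  ring_nf

end ComplexGaussian

/-! ### Strong law for cross-moments -/

section StrongLaw

variable {Ω : Type*} [MeasurableSpace Ω] {P : Measure Ω} [IsProbabilityMeasure P]

/-- The empirical cross-moments of independent arrays of complex Gaussians converge almost surely
to the covariance. -/
theorem ae_tendsto_cross_moment {ι : Type*} [DecidableEq ι] {z : ι × ℕ → Ω → ℂ} {σ : ι → ℝ≥0}
    (hlaw : ∀ i m, HasLaw (z (i, m)) (complexGaussian (σ i)) P) (hindep : iIndepFun z P) (i j : ι) :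
    ∀ᵐ ω ∂P, Tendsto (fun M : ℕ => (M : ℝ)⁻¹ •
      ∑ m ∈ Finset.range M, z (i, m) ω * (starRingEnd ℂ) (z (j, m) ω)) atTop
      (𝓝 (if i = j then ((σ i : ℝ) : ℂ) else 0)) := by
  have haem : ∀ p, AEMeasurable (z p) P := fun p => (hlaw p.1 p.2).aemeasurable
  have hφ : Measurable fun p : ℂ × ℂ => p.1 * (starRingEnd ℂ) p.2 := by fun_prop
  have hL2 : ∀ i, MemLp (z (i, 0)) 2 P := fun i => by
    have h := memLp_two_id_complexGaussian (σ i)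
    rw [← (hlaw i 0).map_eq, memLp_map_measure_iff aestronglyMeasurable_id
      (hlaw i 0).aemeasurable] at h
    exact h
  have hid : ∀ i m, IdentDistrib (z (i, m)) (z (i, 0)) P P := fun i m =>
    ⟨haem _, haem _, (hlaw i m).map_eq.trans (hlaw i 0).map_eq.symm⟩
  have hpair : ∀ m, IdentDistrib (fun ω => (z (i, m) ω, z (j, m) ω))
      (fun ω => (z (i, 0) ω, z (j, 0) ω)) P P := fun m => by
    by_cases hij : i = j
    · subst hij
      exact (hid i m).comp (measurable_id.prodMk measurable_id)
    · exact (hid i m).prodMk (hid j m) (hindep.indepFun (by simp [hij]))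
        (hindep.indepFun (by simp [hij]))
  have hlimit : ∫ ω, z (i, 0) ω * (starRingEnd ℂ) (z (j, 0) ω) ∂P =
      if i = j then ((σ i : ℝ) : ℂ) else 0 := by
    split_ifs with hij
    · subst hij
      rw [← integral_mul_conj_complexGaussian]
      exact (hlaw i 0).integral_comp (f := fun z : ℂ => z * (starRingEnd ℂ) z)
        (by fun_prop)
    · have h1 : IndepFun (z (i, 0)) (fun ω => (starRingEnd ℂ) (z (j, 0) ω)) P :=
        (hindep.indepFun (i := (i, 0)) (j := (j, 0)) (by simp [hij])).comp measurable_id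
          (by fun_prop : Measurable (starRingEnd ℂ))
      rw [h1.integral_fun_mul_eq_mul_integral (haem _).aestronglyMeasurable
        (by have := haem (j, 0); fun_prop), (hlaw i 0).integral_eq, integral_id_complexGaussian,
        zero_mul]
  rw [← hlimit]
  refine strong_law_ae (fun m ω => z (i, m) ω * (starRingEnd ℂ) (z (j, m) ω)) ?_ ?_ ?_
  · exact (hL2 i).integrable_mul (hL2 j).star
  -- Pairwise independence of the products across antennas suffices.
  · intro m m' hmm
    exact (hindep.indepFun_prodMk_prodMk₀ haem (i, m) (j, m) (i, m') (j, m')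
      (by simp [hmm]) (by simp [hmm]) (by simp [hmm]) (by simp [hmm])).comp hφ hφ
  · exact fun m => (hpair m).comp hφ

end StrongLaw

/-! ### Limit of the sample covariance -/

section SampleCovariance

variable {L Nd Q : ℕ} (S : Matrix (Fin L) (Fin Nd × Fin Q) ℂ) (v : ℝ≥0) (g : Fin Nd → ℝ)
  (a : Fin Nd → Fin Q → ℝ)

/-- The matrix mapping the channel gains and the noise at one antenna to the received signal. -/
noncomputable def mixing : Matrix (Fin L) (Fin Nd ⊕ Fin L) ℂ :=
  Matrix.of fun l => Sum.elim (fun n => ∑ q, (a n q : ℂ) * (g n : ℂ) * S l (n, q))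
    (fun l' => if l = l' then 1 else 0)

theorem receivedSignal_apply_eq_sum_mixing (h : Fin Nd → ℕ → ℂ) (w : Fin L → ℕ → ℂ) (M : ℕ)
    (l : Fin L) (m : Fin M) :
    receivedSignal S g a h w M l m =
      ∑ k, mixing S g a l k * Sum.elim (fun n => h n m) (fun l => w l m) k := by
  simp [receivedSignal, mixing, Fintype.sum_sum_type, Finset.sum_mul]

theorem IsIndicator.mul_eq_zero {a : Fin Nd → Fin Q → ℝ} (ha : IsIndicator a) {n : Fin Nd}
    {q q' : Fin Q} (hq : q ≠ q') : a n q * a n q' = 0 := by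
  by_contra hne
  have h1 : a n q = 1 := (ha.1 n q).resolve_left (left_ne_zero_of_mul hne)
  have h2 : a n q' = 1 := (ha.1 n q').resolve_left (right_ne_zero_of_mul hne)
  have h3 : ∑ r ∈ {q, q'}, |a n r| ≤ ∑ r, |a n r| :=
    Finset.sum_le_sum_of_subset_of_nonneg (Finset.subset_univ _) fun _ _ _ => abs_nonneg _
  rw [Finset.sum_pair hq, h1, h2] at h3
  rcases ha.2 n with h | h <;> rw [h] at h3 <;> norm_num at h3

/-- The sequences of one device share a single fading coefficient, so cross terms `q ≠ q'` appear;
they vanish because at most one sequence is sent. The diagonal terms use `a² = a`. -/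
theorem sum_mixing_mul_conj {a : Fin Nd → Fin Q → ℝ} (ha : IsIndicator a) (l l' : Fin L) :
    ∑ k, mixing S g a l k * (starRingEnd ℂ) (mixing S g a l' k) *
        (((Sum.elim (fun _ => 1) (fun _ => v) k : ℝ≥0) : ℝ) : ℂ) =
      modelCov S v (trueGamma g a) l l' := by
  rw [Fintype.sum_sum_type, modelCov, Matrix.add_apply]
  congr 1
  · rw [Matrix.mul_apply, Fintype.sum_prod_type]
    refine Finset.sum_congr rfl fun n _ => ?_
    simp only [mixing, Matrix.of_apply, Sum.elim_inl, map_sum, map_mul, Complex.conj_ofReal,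
      NNReal.coe_one, Complex.ofReal_one, mul_one, Matrix.mul_diagonal, Matrix.conjTranspose_apply,
      trueGamma]
    rw [Finset.sum_mul_sum]
    refine Finset.sum_congr rfl fun q _ => ?_
    rw [Finset.sum_eq_single q]
    · have h1 : (a n q : ℂ) * a n q = a n q := by
        rcases ha.1 n q with h | h <;> simp [h]
      push_cast
      calc _ = ((a n q : ℂ) * a n q) * (g n ^ 2 * S l (n, q) * (starRingEnd ℂ) (S l' (n, q))) := by
            ring
        _ = _ := by rw [h1, ← Complex.star_def]; ring
    · intro q' _ hq
      have h1 : (a n q : ℂ) * a n q' = 0 := by exact_mod_cast ha.mul_eq_zero hq.symm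
      calc _ = ((a n q : ℂ) * a n q') *
            (g n ^ 2 * S l (n, q) * (starRingEnd ℂ) (S l' (n, q'))) := by ring
        _ = 0 := by rw [h1, zero_mul]
    · simp
  · simp only [mixing, Matrix.of_apply, Sum.elim_inr, Matrix.smul_apply, Matrix.one_apply,
      smul_eq_mul]
    rw [Finset.sum_eq_single l]
    · by_cases hl : l = l'
      · simp [hl]
      · simp [hl, Ne.symm hl]
    · intro k _ hk
      simp [Ne.symm hk]
    · simp

/-- The sample covariance converges to the model covariance at the true parameter as soon as the
empirical cross-moments of the channel gains and the noise converge. -/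
theorem tendsto_sampleCov {a : Fin Nd → Fin Q → ℝ} (ha : IsIndicator a) (h : Fin Nd → ℕ → ℂ)
    (w : Fin L → ℕ → ℂ)
    (hlim : ∀ i j, Tendsto (fun M : ℕ => (M : ℝ)⁻¹ • ∑ m ∈ Finset.range M,
      Sum.elim (fun n => h n m) (fun l => w l m) i *
        (starRingEnd ℂ) (Sum.elim (fun n => h n m) (fun l => w l m) j)) atTop
      (𝓝 (if i = j then (((Sum.elim (fun _ => 1) (fun _ => v) i : ℝ≥0) : ℝ) : ℂ) else 0))) :
    Tendsto (fun M => sampleCov (receivedSignal S g a h w M)) atTop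
      (𝓝 (modelCov S v (trueGamma g a))) := by
  refine tendsto_pi_nhds.2 fun l => tendsto_pi_nhds.2 fun l' => ?_
  have hrw : ∀ M, sampleCov (receivedSignal S g a h w M) l l' =
      ∑ i, ∑ j, mixing S g a l i * (starRingEnd ℂ) (mixing S g a l' j) *
        ((M : ℝ)⁻¹ • ∑ m ∈ Finset.range M, Sum.elim (fun n => h n m) (fun l => w l m) i *
        (starRingEnd ℂ) (Sum.elim (fun n => h n m) (fun l => w l m) j)) := fun M => by
    simp only [sampleCov, Matrix.smul_apply, Matrix.mul_apply, Matrix.conjTranspose_apply,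
      receivedSignal_apply_eq_sum_mixing, Complex.star_def, map_sum, map_mul, Finset.sum_mul_sum]
    simp only [Complex.real_smul, smul_eq_mul, Finset.mul_sum, Finset.sum_range]
    rw [Finset.sum_comm]
    refine Finset.sum_congr rfl fun i _ => ?_
    rw [Finset.sum_comm]
    refine Finset.sum_congr rfl fun j _ => Finset.sum_congr rfl fun m _ => ?_
    push_cast
    ring
  simp only [hrw, ← sum_mixing_mul_conj S v g ha]
  refine tendsto_finsetSum _ fun i _ => ?_
  have hsum := tendsto_finsetSum (Finset.univ : Finset (Fin Nd ⊕ Fin L)) fun j _ =>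
    (hlim i j).const_mul (mixing S g a l i * (starRingEnd ℂ) (mixing S g a l' j))
  simpa only [mul_ite, mul_zero, Finset.sum_ite_eq, Finset.mem_univ, if_true] using hsum

end SampleCovariance

end GrantFree

namespace GrantFree

/-! ### The true parameter and the coherence threshold -/

section TrueParameter

variable {L Nd Q : ℕ}

theorem trueGamma_nonneg (g : Fin Nd → ℝ) {a : Fin Nd → Fin Q → ℝ} (ha : IsIndicator a)
    (i : Fin Nd × Fin Q) : 0 ≤ trueGamma g a i := by
  unfold trueGamma
  rcases ha.1 i.1 i.2 with h | h <;> rw [h] <;> positivity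

/-- The number of transmitted sequences is at most the number of active devices. -/
theorem card_filter_eq_one_le_ncard_activeDevices {a : Fin Nd → Fin Q → ℝ} (ha : IsIndicator a) :
    (Finset.univ.filter fun i : Fin Nd × Fin Q => a i.1 i.2 = 1).card ≤
      (activeDevices a).ncard := by
  classical
  rw [Set.ncard_eq_toFinset_card']
  refine Finset.card_le_card_of_injOn Prod.fst (fun i hi => ?_) fun i hi j hj hij => ?_
  · have hi1 : a i.1 i.2 = 1 := by simpa using hi
    have h1 := Finset.single_le_sum (f := fun q => |a i.1 q|) (fun q _ => abs_nonneg _)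
      (Finset.mem_univ i.2)
    rw [Finset.mem_coe, Set.mem_toFinset]
    refine (ha.2 i.1).resolve_left fun h0 => ?_
    rw [h0, hi1] at h1
    norm_num at h1
  · obtain ⟨n, q⟩ := i
    obtain ⟨n', q'⟩ := j
    obtain rfl : n = n' := hij
    have hi1 : a n q = 1 := by simpa using hi
    have hj1 : a n q' = 1 := by simpa using hj
    by_contra hne
    have h0 := ha.mul_eq_zero (n := n) (q := q) (q' := q') fun h => hne (by rw [h])
    rw [hi1, hj1] at h0
    norm_num at h0

/-- The true parameter is determined by its model covariance when the coherence is small. -/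
theorem eq_trueGamma_of_modelCov_eq (S : Matrix (Fin L) (Fin Nd × Fin Q) ℂ)
    (hS : ∀ i, S.col i ≠ 0) (v : ℝ≥0) (g : Fin Nd → ℝ) {a : Fin Nd → Fin Q → ℝ}
    (ha : IsIndicator a) (hμ : (activeDevices a).ncard * coherence S ^ 2 < 1)
    {γ : Fin Nd × Fin Q → ℝ} (hγ : ∀ i, 0 ≤ γ i)
    (h : modelCov S v γ = modelCov S v (trueGamma g a)) : γ = trueGamma g a := by
  -- The difference `γ - γ⁰` can be negative only where a sequence is transmitted.
  refine sub_eq_zero.1 (eq_zero_of_mul_diagonal_mul_conjTranspose_eq_zero S hS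
    (Finset.univ.filter fun i : Fin Nd × Fin Q => a i.1 i.2 = 1) (lt_of_le_of_lt ?_ hμ) _
    (fun i hi => ?_) ?_)
  · gcongr
    exact card_filter_eq_one_le_ncard_activeDevices ha
  · have h0 : a i.1 i.2 = 0 := (ha.1 i.1 i.2).resolve_right (by simpa using hi)
    simpa [trueGamma, h0] using hγ i
  · have h1 : (Matrix.diagonal fun i => ((γ - trueGamma g a) i : ℂ)) =
        Matrix.diagonal (fun i => (γ i : ℂ)) - Matrix.diagonal fun i => (trueGamma g a i : ℂ) := by
      rw [Matrix.diagonal_sub]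
      simp
    rw [h1, Matrix.mul_sub, Matrix.sub_mul, sub_eq_zero]
    exact add_right_cancel h

/-- Since `δ ≥ 1`, `K ≤ K + δ - 1`. -/
theorem natCast_mul_sq_lt_one_of_lt_one_div_sqrt {K δ : ℕ} (hδ : 0 < δ) {μ : ℝ} (hμ0 : 0 ≤ μ)
    (hμ : μ < 1 / Real.sqrt ((K : ℝ) + (δ : ℝ) - 1)) : K * μ ^ 2 < 1 := by
  have hδ' : (1 : ℝ) ≤ δ := by exact_mod_cast hδ
  have hr0 : 0 ≤ (K : ℝ) + δ - 1 := by linarith [Nat.cast_nonneg (α := ℝ) K]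
  -- At `K + δ = 1` the right side of `hμ` is `1 / 0 = 0`, which `0 ≤ μ` rules out; so `K + δ > 1`
  -- needs no separate assumption.
  have hsqrt : 0 < Real.sqrt ((K : ℝ) + δ - 1) := one_div_pos.1 (hμ0.trans_lt hμ)
  rw [lt_div_iff₀ hsqrt] at hμ
  have h1 : (μ * Real.sqrt ((K : ℝ) + δ - 1)) ^ 2 < 1 :=
    pow_lt_one₀ (by positivity) hμ two_ne_zero
  rw [mul_pow, Real.sq_sqrt hr0] at h1
  nlinarith [sq_nonneg μ]

end TrueParameter

/-- Almost surely, all empirical cross-moments of the channel gains and the noise converge. -/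
theorem IsChannelModel.ae_tendsto_cross_moment {L Nd : ℕ} {v : ℝ≥0} {Ω : Type*}
    [MeasurableSpace Ω] {P : Measure Ω} [IsProbabilityMeasure P]
    {h : Fin Nd → ℕ → Ω → ℂ} {w : Fin L → ℕ → Ω → ℂ} (hmodel : IsChannelModel P v h w) :
    ∀ᵐ ω ∂P, ∀ i j : Fin Nd ⊕ Fin L, Tendsto (fun M : ℕ => (M : ℝ)⁻¹ • ∑ m ∈ Finset.range M,
      Sum.elim (fun n => h n m ω) (fun l => w l m ω) i *
        (starRingEnd ℂ) (Sum.elim (fun n => h n m ω) (fun l => w l m ω) j)) atTop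
      (𝓝 (if i = j then (((Sum.elim (fun _ => 1) (fun _ => v) i : ℝ≥0) : ℝ) : ℂ) else 0)) := by
  rw [ae_all_iff]
  intro i
  rw [ae_all_iff]
  intro j
  have hindep : iIndepFun (fun (p : (Fin Nd ⊕ Fin L) × ℕ) ω =>
      Sum.elim (fun n => h n p.2 ω) (fun l => w l p.2 ω) p.1) P := by
    have h1 := hmodel.indep.precomp (Equiv.sumProdDistrib (Fin Nd) (Fin L) ℕ).injective
    convert h1 using 1
    funext p
    obtain ⟨n | l, m⟩ := p <;> rfl
  refine GrantFree.ae_tendsto_cross_moment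
    (σ := Sum.elim (fun _ => (1 : ℝ≥0)) (fun _ => v)) (fun k m => ?_) hindep i j
  rcases k with n | l
  · exact hmodel.law_channel n m
  · exact hmodel.law_noise l m

end GrantFree

theorem mainTheorem1 {L Nd Q K δ : ℕ} (hδ : 0 < δ)
    (S : Matrix (Fin L) (Fin Nd × Fin Q) ℂ) (hS : ∀ i, S.col i ≠ 0)
    (hμ : GrantFree.coherence S < 1 / Real.sqrt ((K : ℝ) + (δ : ℝ) - 1))
    (g : Fin Nd → ℝ) (hg : ∀ n, 0 < g n) (v : ℝ≥0) (hv : 0 < v)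
    {Ω : Type*} [MeasurableSpace Ω] (P : Measure Ω) [IsProbabilityMeasure P]
    (h : Fin Nd → ℕ → Ω → ℂ) (w : Fin L → ℕ → Ω → ℂ)
    (hmodel : GrantFree.IsChannelModel P v h w) :
    ∃ E : Set Ω, MeasurableSet E ∧ 1 - (2 : ℝ) ^ (-(δ : ℤ)) < P.real E ∧
      ∀ ω ∈ E, ∀ a : Fin Nd → Fin Q → ℝ, GrantFree.IsIndicator a →
        (GrantFree.activeDevices a).ncard = K →
        (∀ M, 1 ≤ M → ∃ γ, GrantFree.IsMLEstimate S v (GrantFree.sampleCov (GrantFree.receivedSignal S g a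
            (fun n m => h n m ω) (fun l m => w l m ω) M)) γ) ∧
          ∀ γhat : ℕ → Fin Nd × Fin Q → ℝ,
            (∀ M, 1 ≤ M → GrantFree.IsMLEstimate S v (GrantFree.sampleCov (GrantFree.receivedSignal S g a
            (fun n m => h n m ω) (fun l m => w l m ω) M)) (γhat M)) →
              Tendsto γhat atTop (𝓝 (GrantFree.trueGamma g a)) := by
  have hK := GrantFree.natCast_mul_sq_lt_one_of_lt_one_div_sqrt hδ
    (GrantFree.coherence_nonneg S) hμ
  -- The exceptional set is fixed before any activity pattern is chosen.
  obtain ⟨N, hN, hNm, hN0⟩ :=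
    exists_measurable_superset_of_null (ae_iff.1 hmodel.ae_tendsto_cross_moment)
  refine ⟨Nᶜ, hNm.compl, ?_, fun ω hω a ha hcard => ⟨fun M _ => ?_, fun γhat hML => ?_⟩⟩
  · rw [probReal_compl_eq_one_sub hNm, measureReal_def, hN0, ENNReal.toReal_zero]
    have : (0 : ℝ) < 2 ^ (-(δ : ℤ)) := by positivity
    linarith
  · exact GrantFree.exists_isMLEstimate S hS hv (GrantFree.sampleCov_posSemidef _)
  · have hlim := not_not.1 fun hn => hω (hN hn)
    subst hcard
    exact GrantFree.tendsto_of_isMLEstimate S hS hv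
      (fun _ => GrantFree.sampleCov_posSemidef _) (GrantFree.trueGamma_nonneg g ha)
      (GrantFree.tendsto_sampleCov S v g ha _ _ hlim)
      (fun γ hγ => GrantFree.eq_trueGamma_of_modelCov_eq S hS v g ha hK hγ) hML
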